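/- Let $k\ge 2$. A sequence ${\bf a}=(a(n))_{n\ge 0}$ over a finite alphabet is $k$-automatic if there is a deterministic finite automaton with output which, on reading the base-$k$ representation of $n$ (most significant digit first, without leading zeros, so that $0$ is represented by the empty word), ends in a state whose output is $a(n)$, for every $n\ge 0$. For a nonempty finite word $w$, let $\exp(w)$ be the largest of the numbers $|w|/|x|$ over all nonempty words $x$ such that $w=x^m x'$ for some integer $m\ge 1$ and some prefix $x'$ of $x$. The critical exponent of ${\bf a}$ is $c({\bf a})=\sup\,\exp(w)\in[1,\infty]$, the supremum being over all nonempty finite factors $w={\bf a}[i..i+\ell-1]$ of ${\bf a}$. Theorem. For every integer $k\ge 2$, the critical exponent of every $k$-automatic sequence is either a rational number or $\infty$. Moreover, it is effectively computable: there is a single algorithm (a total computable function) which, given $k\geq 2$ and a deterministic finite automaton with output that generates a $k$-automatic sequence ${\bf a}$ (as a finite table of its initial state, transitions and outputs), returns $\infty$ if $c({\bf a})=\infty$, and otherwise returns integers $p\ge 0$, $q\ge 1$ with $c({\bf a})=p/q$. -/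

import Mathlib

open scoped ENNReal

universe u

/-! ### Periods, exponents and the critical exponent -/

/-- The nonempty word `x` is a period of the word `w`: `w = x ^ n x'` with `n ≥ 1` and `x'` a
prefix of `x`. -/
def IsPeriodOf {Δ : Type u} (x w : List Δ) : Prop :=
  x ≠ [] ∧ ∃ n : ℕ, 1 ≤ n ∧ ∃ x' : List Δ, x' <+: x ∧ w = (List.replicate n x).flatten ++ x'

/-- `exp(w)`: the largest of the numbers `|w| / |x|`, where `x` runs over the periods of `w`.
(A word has only finitely many periods, and a nonempty word has itself as a period.) -/
noncomputable def exponent {Δ : Type u} (w : List Δ) : ℝ≥0∞ :=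
  ⨆ (x : List Δ) (_ : IsPeriodOf x w), (w.length : ℝ≥0∞) / (x.length : ℝ≥0∞)

/-- The factor `a(i) a(i+1) ⋯ a(i+n-1)` of length `n` of the infinite word `a`. -/
def factorAt {Δ : Type u} (a : ℕ → Δ) (i n : ℕ) : List Δ :=
  List.ofFn fun j : Fin n => a (i + j)

/-- The finite word `w` is a factor of the infinite word `a`. -/
def IsFactor {Δ : Type u} (w : List Δ) (a : ℕ → Δ) : Prop :=
  ∃ i n : ℕ, w = factorAt a i n

/-- The critical exponent of `a`: the supremum, in `[0, ∞]`, of `exp(w)` over all nonempty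
factors `w` of `a`. -/
noncomputable def criticalExponent {Δ : Type u} (a : ℕ → Δ) : ℝ≥0∞ :=
  ⨆ (w : List Δ) (_ : w ≠ [] ∧ IsFactor w a), exponent w

/-! ### Automata with output and automatic sequences -/

/-- A deterministic automaton with output, reading words over the digits `{0, …, k-1}`, with
state set `σ` and outputs in `Δ`. -/
structure DFAO (k : ℕ) (σ : Type*) (Δ : Type*) where
  /-- the transition function -/
  step : σ → Fin k → σ
  /-- the initial state -/
  start : σ
  /-- the output attached to each state -/
  output : σ → Δ

/-- The canonical base-`k` representation of `n`: most significant digit first, without leading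
zeros (so that `0` is represented by the empty word). -/
def canonicalRep {k : ℕ} (hk : 2 ≤ k) (n : ℕ) : List (Fin k) :=
  (Nat.digits k n).reverse.pmap (fun d hd => (⟨d, hd⟩ : Fin k))
    (fun _ hd => Nat.digits_lt_base hk (List.mem_reverse.mp hd))

/-- The sequence generated by `M`: its `n`-th term is the output of the state that `M` reaches
from the initial state by reading the canonical base-`k` representation of `n`. -/
def DFAO.sequence {k : ℕ} {σ Δ : Type*} (M : DFAO k σ Δ) (hk : 2 ≤ k) (n : ℕ) : Δ :=
  M.output ((canonicalRep hk n).foldl M.step M.start)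

/-- A sequence is `k`-automatic if some automaton with output and finitely many states
generates it. -/
def IsAutomatic {k : ℕ} (hk : 2 ≤ k) {Δ : Type u} (a : ℕ → Δ) : Prop :=
  ∃ (σ : Type) (_ : Finite σ) (M : DFAO k σ Δ), M.sequence hk = a

/-! ### Automata as finite data -/

/-- The finite description of an automaton with states `0, …, n-1` that is handed to an
algorithm: the base, the initial state, the table whose `(s, d)` entry is the state reached from
the state `s` on the digit `d`, and the list of the (numbers of the) outputs of the states. -/
def DFAO.code {k n : ℕ} {Δ : Type u} [Encodable Δ] (M : DFAO k (Fin n) Δ) :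
    ℕ × ℕ × List (List ℕ) × List ℕ :=
  (k, (M.start : ℕ),
    List.ofFn (fun s : Fin n => List.ofFn fun d : Fin k => (M.step s d : ℕ)),
    List.ofFn (fun s : Fin n => Encodable.encode (M.output s)))

/-- The answer of an algorithm denotes the value `c`: `none` stands for `∞`, and `some (p, q)`
for the rational number `p / q`, where `q` has to be positive. -/
def Denotes : Option (ℕ × ℕ) → ℝ≥0∞ → Prop
  | none, c => c = ∞
  | some (p, q), c => 0 < q ∧ c = (p : ℝ≥0∞) / (q : ℝ≥0∞)

/-! ### Periods of words and the critical exponent -/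

/-! That the factor of length `q` at `i` has period `p` means: for all `j` with `j + p < q`, `a (i +
j) = a (i + j + p)`. Fixing the lowest digits of all variables turns this condition into one of
finitely many of the same kind: carries are bounded, the action of the digits on the states is one
of finitely many maps, and quantifiers are handled by sets of indices. `DigitClosed` captures this
for relations on numbers, so no automata on tuples of words are built.

In a finite family, a large tuple has a block of digits that can be deleted or repeated
(`exists_pump`); this changes the tuple by multiples of a vector `A` with bounded entries. For pairs
`(p, q)` with `q / p ≤ C` throughout, repeating the block drives the ratio to the slope of `A`, so
this slope is at most `C`. The ratio of the original pair lies between the slope of `A` and the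
ratio of the shortened pair. By descent, each `q / p` is at most some fraction of bounded height
that is itself at most `C` (`exists_small_ratio`). There are finitely many such fractions, so a
finite supremum is one of them.

For computability, adding the inequality `u p < v q` to the family bounds the least witness of an
exponent above `u / v`, so being an upper bound is decided by a finite search. The least upper bound
among fractions of bounded height is the critical exponent; if there is none, the exponent is
infinite. -/

theorem isPeriodOf_iff {Δ : Type u} (x w : List Δ) :
    IsPeriodOf x w ↔ x ≠ [] ∧ ∃ t, w = x ++ t ∧ t <+: w := by
  constructor
  · rintro ⟨hx, n, hn, x', hx', rfl⟩
    refine ⟨hx, ?_⟩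
    obtain ⟨n, rfl⟩ := Nat.exists_eq_add_of_le' hn
    refine ⟨(List.replicate n x).flatten ++ x', by simp [List.replicate_succ], ?_⟩
    rw [List.replicate_succ', List.flatten_append, List.append_assoc]
    refine (List.prefix_append_right_inj _).2 ?_
    simpa using hx'.trans (List.prefix_append x x')
  · rintro ⟨hx, t, rfl, ht⟩
    refine ⟨hx, ?_⟩
    induction h : t.length using Nat.strong_induction_on generalizing t with
    | _ l ih =>
      rcases List.prefix_or_prefix_of_prefix ht (List.prefix_append x t) with h1 | ⟨s, rfl⟩
      · exact ⟨1, le_rfl, t, h1, by simp⟩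
      · have hs : s <+: x ++ s := (List.prefix_append_right_inj x).1 ht
        have hlt : s.length < l := by
          have := List.length_pos_iff.2 hx
          simp only [List.length_append] at h
          omega
        obtain ⟨n, hn, x', hx', he⟩ := ih _ hlt s hs rfl
        exact ⟨n + 1, by omega, x', hx', by rw [he]; simp [List.replicate_succ]⟩

@[simp] theorem length_factorAt {Δ : Type u} (a : ℕ → Δ) (i n : ℕ) :
    (factorAt a i n).length = n := by simp [factorAt]

theorem getElem_factorAt {Δ : Type u} (a : ℕ → Δ) (i n j : ℕ) (h : j < (factorAt a i n).length) :
    (factorAt a i n)[j] = a (i + j) := by simp [factorAt]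

theorem isPeriodOf_factorAt {Δ : Type u} (a : ℕ → Δ) (i p q : ℕ) (hp : 0 < p) (hpq : p ≤ q)
    (h : ∀ j, j + p < q → a (i + j) = a (i + j + p)) :
    IsPeriodOf (factorAt a i p) (factorAt a i q) := by
  refine (isPeriodOf_iff _ _).2 ⟨?_, factorAt a (i + p) (q - p), ?_, ?_⟩
  · rw [← List.length_pos_iff, length_factorAt]; exact hp
  · refine List.ext_getElem (by simp; omega) fun j h1 h2 => ?_
    rw [getElem_factorAt, List.getElem_append]
    split_ifs with h3
    · rw [getElem_factorAt]
    · rw [getElem_factorAt]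
      simp only [length_factorAt, not_lt] at h3 ⊢
      congr 1; omega
  · rw [List.prefix_iff_getElem]
    refine ⟨by simp, fun j hj => ?_⟩
    rw [getElem_factorAt, getElem_factorAt, add_right_comm]
    simp only [length_factorAt] at hj
    exact (h j (by omega)).symm

theorem IsPeriodOf.apply_eq {Δ : Type u} {a : ℕ → Δ} {i q : ℕ} {x : List Δ}
    (h : IsPeriodOf x (factorAt a i q)) (j : ℕ) (hj : j + x.length < q) :
    a (i + j) = a (i + j + x.length) := by
  obtain ⟨-, t, he, ht⟩ := (isPeriodOf_iff _ _).1 h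
  have hl : q = x.length + t.length := by simpa using congrArg List.length he
  have h1 := List.prefix_iff_getElem.1 ht
  obtain ⟨_, h1⟩ := h1
  have h2 := h1 j (by omega)
  rw [getElem_factorAt] at h2
  rw [← h2, add_assoc, ← getElem_factorAt a i q (j + x.length) (by simpa using hj)]
  simp only [he]
  rw [List.getElem_append_right (by omega)]
  simp

/-- The factor of `a` of length `q` at position `i` has period `p`. -/
def HasRepetition {Δ : Type u} (a : ℕ → Δ) (i p q : ℕ) : Prop :=
  ∀ j, j + p < q → a (i + j) = a (i + j + p)

/-- The case `q ≤ p` does no harm: its quotient is at most 1, the exponent of a one-letter factor.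
-/
theorem criticalExponent_le_iff {Δ : Type u} (a : ℕ → Δ) (x : ℝ≥0∞) :
    criticalExponent a ≤ x ↔
      ∀ i p q, 0 < p → HasRepetition a i p q → (q : ℝ≥0∞) / (p : ℝ≥0∞) ≤ x := by
  simp only [criticalExponent, exponent, iSup_le_iff]
  constructor
  · intro h
    have key : ∀ i p q, 0 < p → p ≤ q → HasRepetition a i p q →
        (q : ℝ≥0∞) / (p : ℝ≥0∞) ≤ x := by
      intro i p q hp hpq hr
      have := h (factorAt a i q)
        ⟨by rw [← List.length_pos_iff, length_factorAt]; omega, i, q, rfl⟩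
        (factorAt a i p) (isPeriodOf_factorAt a i p q hp hpq hr)
      simpa using this
    intro i p q hp hr
    rcases le_total p q with hpq | hpq
    · exact key i p q hp hpq hr
    · refine le_trans ?_ (key 0 1 1 one_pos le_rfl fun j hj => by omega)
      simp only [Nat.cast_one, div_one]
      exact ENNReal.div_le_of_le_mul (by rw [one_mul]; exact_mod_cast hpq)
  · rintro h w ⟨hw, i, q, rfl⟩ y hy
    rw [length_factorAt]
    exact h i y.length q (List.length_pos_iff.2 hy.1) fun j hj => hy.apply_eq j hj

/-! ### Families of relations closed under decimation -/

/-- A family of relations on `ℕ^ι` is closed under decimation in base `k` if, fixing the least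
significant digits of all arguments, one gets another member of the family. -/
def DigitClosed (k : ℕ) {σ ι : Type*} (R : σ → (ι → ℕ) → Prop) : Prop :=
  ∀ s (d : ι → ℕ), (∀ i, d i < k) → ∃ s', ∀ z, R s (fun i => d i + k * z i) ↔ R s' z

/-! ### Pumping in finite families. -/

namespace DigitClosed

variable {k : ℕ} {σ ι : Type*} {R : σ → (ι → ℕ) → Prop}

theorem pow (hR : DigitClosed k R) (hk : 2 ≤ k) (e : ℕ) : DigitClosed (k ^ e) R := by
  induction e with
  | zero =>
    intro s d hd
    have : d = 0 := funext fun i => by simpa using hd i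
    exact ⟨s, fun z => by simp [this]⟩
  | succ e ih =>
    intro s d hd
    obtain ⟨s1, h1⟩ := hR s (fun i => d i % k) fun i => Nat.mod_lt _ (by omega)
    obtain ⟨s2, h2⟩ := ih s1 (fun i => d i / k) fun i =>
      Nat.div_lt_of_lt_mul (by rw [← pow_succ']; exact hd i)
    refine ⟨s2, fun z => ?_⟩
    rw [← h2, ← h1]
    refine iff_of_eq (congrArg _ (funext fun i => ?_))
    rw [mul_add, ← add_assoc, Nat.mod_add_div, pow_succ']
    ring

/-- Pigeonhole on the relations left after removing low digits. The block is deleted for `m = 0`,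
and `m = 1` gives back `x`. -/
theorem exists_pump [Fintype σ] [Finite ι] (hR : DigitClosed k R) (hk : 2 ≤ k) {s : σ} {x : ι → ℕ}
    (hx : R s x) (hlarge : ∃ i, k ^ Fintype.card σ ≤ x i) :
    ∃ (y A : ι → ℕ) (e b : ℕ), A ≠ 0 ∧ (∀ i, A i < k ^ (Fintype.card σ + 1)) ∧
      (∀ i, x i = y i + k ^ e * A i) ∧
      ∀ m, R s fun i => y i + k ^ e * (∑ t ∈ Finset.range m, k ^ (b * t)) * A i := by
  classical
  cases nonempty_fintype ι
  have hk0 : 0 < k := by omega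
  have hex : ∃ L, ∀ i, x i < k ^ L := by
    refine ⟨∑ i, x i, fun i => lt_of_le_of_lt ?_ (Nat.lt_pow_self (by omega))⟩
    exact Finset.single_le_sum (f := x) (fun _ _ => Nat.zero_le _) (Finset.mem_univ i)
  set N := Fintype.card σ with hN
  obtain ⟨L, hL, hmin⟩ : ∃ L, (∀ i, x i < k ^ L) ∧ ∀ L' < L, ∃ i, k ^ L' ≤ x i :=
    ⟨Nat.find hex, Nat.find_spec hex, fun L' h => by simpa using Nat.find_min hex h⟩
  have hNL : N < L := by
    obtain ⟨i, hi⟩ := hlarge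
    exact (Nat.pow_lt_pow_iff_right (by omega)).1 (hi.trans_lt (hL i))
  have hst : ∀ e, ∃ s', ∀ z, R s (fun i => x i % k ^ e + k ^ e * z i) ↔ R s' z := fun e =>
    hR.pow hk e s (fun i => x i % k ^ e) fun i => Nat.mod_lt _ (by positivity)
  choose st hst using hst
  -- Only the top `N + 1` cut positions compete: the lower limit keeps `A` below `k ^ (N + 1)`, the
  -- upper one leaves a nonzero digit above the block, whence `A ≠ 0`.
  obtain ⟨t1, t2, hne, heq⟩ := Fintype.exists_ne_map_eq_of_card_lt
    (fun t : Fin (N + 1) => st (L - 1 - N + t)) (by simp [hN])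
  obtain ⟨e, b, hb, he1, he2, hef⟩ : ∃ e b, 0 < b ∧ L - 1 - N ≤ e ∧ e + b ≤ L - 1 ∧
      st e = st (e + b) := by
    rcases lt_or_gt_of_ne (Fin.val_ne_of_ne hne) with h | h
    · refine ⟨L - 1 - N + t1, t2 - t1, by omega, by omega, by omega, ?_⟩
      rw [show L - 1 - N + t1 + ((t2 : ℕ) - t1) = L - 1 - N + t2 by omega]; exact heq
    · refine ⟨L - 1 - N + t2, t1 - t2, by omega, by omega, by omega, ?_⟩
      rw [show L - 1 - N + t2 + ((t1 : ℕ) - t2) = L - 1 - N + t1 by omega]; exact heq.symm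
  have hstep : ∀ w, R (st e) w → R (st e) fun i => x i / k ^ e % k ^ b + k ^ b * w i := by
    intro w hw
    rw [← hst]
    rw [hef, ← hst] at hw
    convert hw using 2 with i
    rw [pow_add, Nat.mod_mul]
    ring
  have hdiv : ∀ i, x i / k ^ e = x i / k ^ e / k ^ b + (x i / k ^ e - x i / k ^ e / k ^ b) :=
    fun i => (Nat.add_sub_of_le (Nat.div_le_self _ _)).symm
  refine ⟨fun i => x i % k ^ e + k ^ e * (x i / k ^ e / k ^ b),
    fun i => x i / k ^ e - x i / k ^ e / k ^ b, e, b, ?_, ?_, ?_, ?_⟩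
  · obtain ⟨i, hi⟩ := hmin (L - 1) (by omega)
    intro h0
    have h0 := congrFun h0 i
    simp only [Pi.zero_apply] at h0
    have h1 : 1 ≤ x i / k ^ e := by
      rw [Nat.le_div_iff_mul_le (by positivity), one_mul]
      exact (Nat.pow_le_pow_right hk0 (by omega)).trans hi
    have : x i / k ^ e / k ^ b < x i / k ^ e :=
      Nat.div_lt_self h1 (Nat.one_lt_pow hb.ne' (by omega))
    omega
  · intro i
    refine lt_of_le_of_lt (Nat.sub_le _ _) (Nat.div_lt_of_lt_mul ((hL i).trans_le ?_))
    rw [← pow_add]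
    exact Nat.pow_le_pow_right hk0 (by omega)
  · intro i
    rw [add_assoc, ← mul_add, ← hdiv, Nat.mod_add_div]
  · intro m
    -- The part above the block satisfies the relation at `e` since those at `e` and `e + b` agree;
    -- each further step inserts one copy of the block at the bottom.
    have hG : ∀ m, R (st e) fun i => x i / k ^ e / k ^ b +
        (∑ t ∈ Finset.range m, k ^ (b * t)) * (x i / k ^ e - x i / k ^ e / k ^ b) := by
      intro m
      induction m with
      | zero =>
        rw [hef, ← hst]
        convert hx using 2 with i
        simp only [Finset.range_zero, Finset.sum_empty, zero_mul, add_zero]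
        rw [Nat.div_div_eq_div_mul, ← pow_add, Nat.mod_add_div]
      | succ m ih =>
        convert hstep _ ih using 2 with i
        have h1 := Nat.mod_add_div (x i / k ^ e) (k ^ b)
        have h2 := hdiv i
        generalize x i / k ^ e - x i / k ^ e / k ^ b = A at *
        generalize x i / k ^ e / k ^ b = z at *
        rw [Finset.sum_range_succ', Finset.sum_congr rfl
          (fun t _ => show k ^ (b * (t + 1)) = k ^ b * k ^ (b * t) by ring), ← Finset.mul_sum]
        simp only [mul_zero, pow_zero]
        linear_combination -h2 - h1
    have := (hst e _).2 (hG m)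
    convert this using 2 with i
    ring

theorem exists_small [Fintype σ] [Finite ι] (hR : DigitClosed k R) (hk : 2 ≤ k) {s : σ}
    {x : ι → ℕ} (hx : R s x) : ∃ y, R s y ∧ ∀ i, y i < k ^ Fintype.card σ := by
  cases nonempty_fintype ι
  induction h : ∑ i, x i using Nat.strong_induction_on generalizing x with
  | _ l ih =>
    by_cases hl : ∃ i, k ^ Fintype.card σ ≤ x i
    · obtain ⟨y, A, e, b, hA, -, hxy, hm⟩ := hR.exists_pump hk hx hl
      have hy : R s y := by simpa using hm 0
      refine ih _ ?_ hy rfl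
      rw [← h]
      obtain ⟨i, hi⟩ := Function.ne_iff.1 hA
      refine Finset.sum_lt_sum (fun i _ => by rw [hxy i]; exact Nat.le_add_right _ _)
        ⟨i, Finset.mem_univ i, ?_⟩
      rw [hxy i]
      exact Nat.lt_add_of_pos_right (Nat.mul_pos (by positivity) (Nat.pos_of_ne_zero hi))
    · exact ⟨x, hx, by simpa using hl⟩

/-- Pumping bounds every ratio `x 1 / x 0` in the relation by a ratio of small height which
is still at most the supremum. -/
theorem exists_small_ratio [Fintype σ] {R : σ → (Fin 2 → ℕ) → Prop} (hR : DigitClosed k R)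
    (hk : 2 ≤ k) {s : σ} (hpos : ∀ x, R s x → 0 < x 0) {C : ℝ}
    (hC : ∀ x, R s x → (x 1 : ℝ) ≤ C * x 0) {x : Fin 2 → ℕ} (hx : R s x) :
    ∃ u v : ℕ, 0 < v ∧ u < k ^ (Fintype.card σ + 1) ∧ v < k ^ (Fintype.card σ + 1) ∧
      (u : ℝ) ≤ C * v ∧ x 1 * v ≤ u * x 0 := by
  induction h : x 0 + x 1 using Nat.strong_induction_on generalizing x with
  | _ l ih =>
    by_cases hl : ∃ i, k ^ Fintype.card σ ≤ x i
    · obtain ⟨y, A, e, b, hA, hlt, hxy, hm⟩ := hR.exists_pump hk hx hl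
      have hy : R s y := by simpa using hm 0
      have hke : 0 < k ^ e := by positivity
      have hC0 : 0 ≤ C := by
        have h0 := hpos y hy
        have h1 := hC y hy
        by_contra hneg
        push Not at hneg
        have : C * (y 0 : ℝ) < 0 := mul_neg_of_neg_of_pos hneg (by exact_mod_cast h0)
        have h2 : (0 : ℝ) ≤ y 1 := Nat.cast_nonneg _
        linarith
      -- Otherwise sufficiently many repetitions of the block would violate the bound `C`.
      have hA1 : (A 1 : ℝ) ≤ C * A 0 := by
        by_contra hlt
        push Not at hlt
        obtain ⟨m, hm'⟩ := exists_nat_gt (C * y 0 / (A 1 - C * A 0))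
        rw [div_lt_iff₀ (by linarith)] at hm'
        have h1 := hC _ (hm m)
        have hg : m ≤ k ^ e * ∑ t ∈ Finset.range m, k ^ (b * t) := by
          have : m ≤ ∑ t ∈ Finset.range m, k ^ (b * t) := by
            calc m = ∑ t ∈ Finset.range m, 1 := by simp
              _ ≤ _ := Finset.sum_le_sum fun t _ => Nat.one_le_pow _ _ (by omega)
          nlinarith
        generalize k ^ e * ∑ t ∈ Finset.range m, k ^ (b * t) = g at *
        push_cast at h1
        have hg' : (m : ℝ) ≤ g := by exact_mod_cast hg
        have h2 : (0 : ℝ) ≤ y 1 := Nat.cast_nonneg _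
        have h3 : (m : ℝ) * (A 1 - C * A 0) ≤ g * (A 1 - C * A 0) :=
          mul_le_mul_of_nonneg_right hg' (by linarith)
        linarith
      have hA0 : 0 < A 0 := by
        rcases Nat.eq_zero_or_pos (A 0) with h0 | h0
        · have h1 : A 1 = 0 := by
            rw [h0] at hA1
            simpa using hA1
          exact absurd (funext fun i => by fin_cases i <;> simp [h0, h1]) hA
        · exact h0
      obtain ⟨u, v, hv, hu1, hv1, huv, hyuv⟩ := ih (y 0 + y 1) (by
        rw [← h, hxy 0, hxy 1]
        have : 0 < k ^ e * A 0 := Nat.mul_pos hke hA0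
        omega) hy rfl
      -- Since `x` is `y` plus a multiple of `A`, the larger of `u / v` and the slope of `A` bounds
      -- its ratio.
      rcases le_total (A 1 * v) (u * A 0) with hle | hle
      · refine ⟨u, v, hv, hu1, hv1, huv, ?_⟩
        rw [hxy 0, hxy 1]
        nlinarith [Nat.mul_le_mul_left (k ^ e) hle]
      · refine ⟨A 1, A 0, hA0, hlt 1, hlt 0, hA1, ?_⟩
        have : y 1 * A 0 ≤ A 1 * y 0 := by
          refine Nat.le_of_mul_le_mul_right ?_ hv
          calc y 1 * A 0 * v = y 1 * v * A 0 := by ring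
            _ ≤ u * y 0 * A 0 := Nat.mul_le_mul_right _ hyuv
            _ = u * A 0 * y 0 := by ring
            _ ≤ A 1 * v * y 0 := Nat.mul_le_mul_right _ hle
            _ = A 1 * y 0 * v := by ring
        rw [hxy 0, hxy 1]
        nlinarith
    · push Not at hl
      have hk' : k ^ Fintype.card σ ≤ k ^ (Fintype.card σ + 1) :=
        Nat.pow_le_pow_right (by omega) (by omega)
      exact ⟨x 1, x 0, hpos x hx, (hl 1).trans_le hk', (hl 0).trans_le hk', hC x hx, le_rfl⟩

end DigitClosed

/-! ### Closure under conjunction, substitution and quantifiers. -/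

namespace DigitClosed

variable {k : ℕ}

theorem and {σ τ ι : Type*} {R : σ → (ι → ℕ) → Prop} {T : τ → (ι → ℕ) → Prop}
    (hR : DigitClosed k R) (hT : DigitClosed k T) :
    DigitClosed k fun (s : σ × τ) z => R s.1 z ∧ T s.2 z := by
  rintro ⟨s, t⟩ d hd
  obtain ⟨s', hs⟩ := hR s d hd
  obtain ⟨t', ht⟩ := hT t d hd
  exact ⟨(s', t'), fun z => and_congr (hs z) (ht z)⟩

theorem comp {σ ι κ : Type*} {R : σ → (ι → ℕ) → Prop} (hR : DigitClosed k R) (f : ι → κ) :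
    DigitClosed k fun s (z : κ → ℕ) => R s (z ∘ f) := fun s d hd =>
  (hR s (d ∘ f) fun i => hd (f i)).imp fun _ h z => h (z ∘ f)

theorem cons_digits {n : ℕ} (j : ℕ) (d z : Fin n → ℕ) :
    (Fin.cons j (fun i => d i + k * z i) : Fin (n + 1) → ℕ) =
      fun i => (Fin.cons (j % k) d : Fin (n + 1) → ℕ) i +
        k * (Fin.cons (j / k) z : Fin (n + 1) → ℕ) i := by
  funext i
  refine Fin.cases ?_ (fun i => ?_) i
  · simp [Nat.mod_add_div]
  · simp

/-- Subset construction: the lowest digit of `j` is unknown, so the successors for all `k` digits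
are collected. As `j` is a number, it may be longer than the entries of `z` without any treatment of
leading zeros. -/
theorem all {σ : Type*} {n : ℕ} {R : σ → (Fin (n + 1) → ℕ) → Prop} (hk : 0 < k)
    (hR : DigitClosed k R) :
    DigitClosed k fun (S : Set σ) (z : Fin n → ℕ) => ∀ s ∈ S, ∀ j, R s (Fin.cons j z) := by
  intro S d hd
  have hd' : ∀ j, ∀ i, (Fin.cons (j % k) d : Fin (n + 1) → ℕ) i < k := fun j i =>
    Fin.cases (by simpa using Nat.mod_lt _ hk) (fun i => by simpa using hd i) i
  choose f hf using fun s j => hR s (Fin.cons (j % k) d) (hd' j)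
  refine ⟨{s' | ∃ s ∈ S, ∃ j < k, s' = f s j}, fun z => ⟨?_, ?_⟩⟩
  · rintro h _ ⟨s, hs, j, hj, rfl⟩ w
    rw [← hf]
    have := h s hs (j + k * w)
    rw [cons_digits] at this
    simpa [Nat.add_mul_div_left _ _ hk, Nat.div_eq_of_lt hj] using this
  · intro h s hs j
    have := h _ ⟨s, hs, j % k, Nat.mod_lt _ hk, rfl⟩ (j / k)
    rw [← hf, Nat.mod_mod] at this
    rw [cons_digits]
    exact this

theorem ex {σ : Type*} {n : ℕ} {R : σ → (Fin (n + 1) → ℕ) → Prop} (hk : 0 < k)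
    (hR : DigitClosed k R) :
    DigitClosed k fun (S : Set σ) (z : Fin n → ℕ) => ∃ s ∈ S, ∃ j, R s (Fin.cons j z) := by
  have hn : DigitClosed k fun s z => ¬ R s z := fun s d hd =>
    (hR s d hd).imp fun _ h z => not_congr (h z)
  intro S d hd
  obtain ⟨S', h⟩ := hn.all hk S d hd
  refine ⟨S', fun z => ?_⟩
  have := not_congr (h z)
  push Not at this
  exact this

end DigitClosed

/-! ### Comparing fractions and carries. -/

theorem natCast_div_le_div_iff {u v p q : ℕ} (hp : 0 < p) (hv : 0 < v) :
    (q : ℝ≥0∞) / p ≤ (u : ℝ≥0∞) / v ↔ q * v ≤ u * p := by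
  rw [ENNReal.div_le_iff (by exact_mod_cast hp.ne') (by simp), ← ENNReal.mul_div_right_comm,
    ENNReal.le_div_iff_mul_le (by left; exact_mod_cast hv.ne') (by simp)]
  exact_mod_cast Iff.rfl

theorem mul_add_le_mul_iff {k : ℕ} (hk : 0 < k) (A X B : ℕ) :
    k * A + X ≤ k * B ↔ A + (X + k - 1) / k ≤ B := by
  have h1 := Nat.div_add_mod (X + k - 1) k
  have h2 := Nat.mod_lt (X + k - 1) hk
  generalize (X + k - 1) / k = c at *
  generalize (X + k - 1) % k = r at *
  constructor
  · intro h
    by_contra hlt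
    have : k * (B + 1) ≤ k * (A + c) := Nat.mul_le_mul_left _ (by omega)
    rw [mul_add, mul_add] at this
    omega
  · intro h
    have : k * (A + c) ≤ k * B := Nat.mul_le_mul_left _ h
    rw [mul_add] at this
    omega

/-! ### The families describing repetitions -/

/-- The linear inequalities `u p < v q`, with a carry. -/
def LinRel (u v : ℕ) (c : Fin (u + v + 2)) (z : Fin 2 → ℕ) : Prop :=
  u * z 0 + c ≤ v * z 1 + v

/-- The new carry is a rounded-up quotient by `k`. The summand `v` on the right of `LinRel` shifts
the carries, which may be as low as `-v`, into the natural numbers. -/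
theorem digitClosed_linRel {k : ℕ} (hk : 2 ≤ k) (u v : ℕ) : DigitClosed k (LinRel u v) := by
  rintro ⟨c, hc⟩ d hd
  have hk0 : 0 < k := by omega
  refine ⟨⟨(u * d 0 + c + v * (k - 1 - d 1) + k - 1) / k, ?_⟩, fun z => ?_⟩
  · rw [Nat.div_lt_iff_lt_mul hk0]
    obtain ⟨k, rfl⟩ := Nat.exists_eq_add_of_le' hk
    have h1 : u * d 0 ≤ u * (k + 1) := Nat.mul_le_mul_left _ (by have := hd 0; omega)
    have h2 : v * (k + 2 - 1 - d 1) ≤ v * (k + 1) := Nat.mul_le_mul_left _ (by omega)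
    have : (u + v + 2) * (k + 2) = u * (k + 1) + v * (k + 1) + (u + v + 1) + (2 * k + 3) := by ring
    omega
  · simp only [LinRel]
    rw [← mul_add_le_mul_iff hk0 (u * z 0) _ (v * z 1 + v)]
    obtain ⟨e, he⟩ : ∃ e, k = d 1 + e + 1 := ⟨k - 1 - d 1, by have := hd 1; omega⟩
    have h3 : k - 1 - d 1 = e := by omega
    rw [h3]
    have h4 : v * k = v * d 1 + v * e + v := by rw [he]; ring
    have h5 : u * (d 0 + k * z 0) = u * d 0 + k * (u * z 0) := by ring
    have h6 : v * (d 1 + k * z 1) = v * d 1 + k * (v * z 1) := by ring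
    have h7 : k * (v * z 1 + v) = k * (v * z 1) + v * k := by ring
    rw [h5, h6, h7, h4]
    omega

/-- The condition `0 < p`, which may have been fulfilled by the digits already read. -/
def PosRel (b : Bool) (z : Fin 2 → ℕ) : Prop := b = true ∨ 0 < z 0

theorem digitClosed_posRel {k : ℕ} (hk : 2 ≤ k) : DigitClosed k PosRel := by
  intro b d _
  refine ⟨b || decide (0 < d 0), fun z => ?_⟩
  have : 0 < k * z 0 ↔ 0 < z 0 := by simp [show 0 < k by omega]
  simp only [PosRel, Bool.or_eq_true, decide_eq_true_eq, Nat.add_pos_iff_pos_or_pos, this, or_assoc]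

/-- The indices of the relations `RepRel`: two maps between states, and three carries. -/
abbrev RepIndex (σ : Type*) := (σ → σ) × (σ → σ) × Fin 4 × Fin 2 × Fin 3

/-- The matrix of the formula expressing a repetition, in the variables `j, i, p, q`,
with carries. -/
def RepRel {σ : Type*} {Δ : Type u} (st : ℕ → σ) (out : σ → Δ) (s : RepIndex σ)
    (z : Fin 4 → ℕ) : Prop :=
  z 0 + z 2 + s.2.2.1 ≤ z 3 + 1 →
    out (s.1 (st (z 1 + z 0 + s.2.2.2.1))) = out (s.2.1 (st (z 1 + z 0 + z 2 + s.2.2.2.2)))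

/-- `st` reads the most significant digit first, whereas decimation strips the least significant
one. The effect of stripped digits is therefore stored as a map, to be applied to the state reached
on the remaining digits. -/
theorem digitClosed_repRel {k : ℕ} (hk : 2 ≤ k) {σ : Type*} {Δ : Type u} {st : ℕ → σ}
    {step : σ → ℕ → σ} (hst : ∀ m d, d < k → st (d + k * m) = step (st m) d) (out : σ → Δ) :
    DigitClosed k (RepRel st out) := by
  rintro ⟨f, g, ⟨c, hc⟩, ⟨c1, hc1⟩, ⟨c2, hc2⟩⟩ d hd
  have hk0 : 0 < k := by omega
  have h0 := hd 0
  have h1 := hd 1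
  have h2 := hd 2
  have h3 := hd 3
  refine ⟨(fun x => f (step x ((d 1 + d 0 + c1) % k)), fun x => g (step x ((d 1 + d 0 + d 2 + c2) % k)),
    ⟨(d 0 + d 2 + c + (k - 1 - d 3) + k - 1) / k, ?_⟩, ⟨(d 1 + d 0 + c1) / k, ?_⟩,
    ⟨(d 1 + d 0 + d 2 + c2) / k, ?_⟩), fun z => ?_⟩
  · rw [Nat.div_lt_iff_lt_mul hk0]; omega
  · rw [Nat.div_lt_iff_lt_mul hk0]; omega
  · rw [Nat.div_lt_iff_lt_mul hk0]; omega
  · simp only [RepRel]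
    rw [← hst _ _ (Nat.mod_lt _ hk0), ← hst _ _ (Nat.mod_lt _ hk0),
      ← mul_add_le_mul_iff hk0 (z 0 + z 2) _ (z 3 + 1), mul_add, mul_add, mul_add, mul_add,
      ← add_assoc, ← add_assoc, mul_add, mul_add]
    have e1 := Nat.mod_add_div (d 1 + d 0 + c1) k
    have e2 := Nat.mod_add_div (d 1 + d 0 + d 2 + c2) k
    have e3 := mul_add k (z 1) (z 0)
    have e4 := mul_add k (z 0) (z 2)
    refine imp_congr (by omega) (iff_of_eq ?_)
    congr 4 <;> omega

/-- The number of relations in the family `RepRel`, for `s` states. -/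
def repIndexCard (s : ℕ) : ℕ := s ^ s * (s ^ s * 24)

theorem card_repIndex (σ : Type*) [Fintype σ] [DecidableEq σ] :
    Fintype.card (RepIndex σ) = repIndexCard (Fintype.card σ) := by
  simp [RepIndex, repIndexCard]

theorem hasRepetition_iff {σ : Type*} {Δ : Type u} (st : ℕ → σ) (out : σ → Δ) (z : Fin 3 → ℕ) :
    HasRepetition (fun m => out (st m)) (z 0) (z 1) (z 2) ↔
      ∀ s ∈ ({(id, id, 2, 0, 0)} : Set (RepIndex σ)), ∀ j, RepRel st out s (Fin.cons j z) := by
  simp only [Set.mem_singleton_iff, forall_eq, RepRel, HasRepetition]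
  refine forall_congr' fun j => imp_congr ?_ Iff.rfl
  change _ ↔ j + z 1 + 2 ≤ z 2 + 1
  omega

/-- If there is a repetition of exponent greater than `u / v`, then there is one of bounded length
at a bounded position. -/
theorem exists_small_hasRepetition {k : ℕ} (hk : 2 ≤ k) {σ : Type*} [Fintype σ] {Δ : Type u}
    {st : ℕ → σ} {step : σ → ℕ → σ} (hst : ∀ m d, d < k → st (d + k * m) = step (st m) d)
    (out : σ → Δ) {u v i p q : ℕ} (hp : 0 < p) (hr : HasRepetition (fun m => out (st m)) i p q)
    (h : u * p < v * q) {B : ℕ}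
    (hB : k ^ (2 ^ repIndexCard (Fintype.card σ) * (2 * (u + v + 2))) ≤ B) :
    ∃ i < B, ∃ p < B, ∃ q < B, 0 < p ∧ u * p < v * q ∧
      HasRepetition (fun m => out (st m)) i p q := by
  classical
  -- The position stays a free variable, because the search needs a bound for it too.
  have hc := ((digitClosed_repRel hk hst out).all (by omega)).and
    (((digitClosed_posRel hk).and (digitClosed_linRel hk u v)).comp (Fin.succ : Fin 2 → Fin 3))
  have key : ∀ z : Fin 3 → ℕ, (0 < z 1 ∧ u * z 1 < v * z 2 ∧
      HasRepetition (fun m => out (st m)) (z 0) (z 1) (z 2)) ↔ _ := fun z =>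
    (show _ ↔ (∀ s ∈ ({(id, id, 2, 0, 0)} : Set (RepIndex σ)), ∀ j, RepRel st out s (Fin.cons j z)) ∧
        PosRel false (z ∘ Fin.succ) ∧ LinRel u v ⟨v + 1, by omega⟩ (z ∘ Fin.succ) by
      rw [hasRepetition_iff]
      have : LinRel u v ⟨v + 1, by omega⟩ (z ∘ Fin.succ) ↔ u * z 1 < v * z 2 := by
        change u * z 1 + (v + 1) ≤ v * z 2 + v ↔ _
        omega
      rw [this]
      have : PosRel false (z ∘ Fin.succ) ↔ 0 < z 1 := by
        simp [PosRel]
      rw [this]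
      tauto)
  obtain ⟨y, hy, hlt⟩ := hc.exists_small hk (s := (_, false, ⟨v + 1, by omega⟩))
    ((key ![i, p, q]).1 ⟨hp, h, hr⟩)
  obtain ⟨h1, h2, h3⟩ := (key y).2 hy
  have hcard : Fintype.card (Set (RepIndex σ) × Bool × Fin (u + v + 2)) =
      2 ^ repIndexCard (Fintype.card σ) * (2 * (u + v + 2)) := by
    rw [Fintype.card_prod, Fintype.card_prod, Fintype.card_set, card_repIndex, Fintype.card_bool,
      Fintype.card_fin]
  rw [hcard] at hlt
  exact ⟨y 0, (hlt 0).trans_le hB, y 1, (hlt 1).trans_le hB, y 2, (hlt 2).trans_le hB, h1, h2, h3⟩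

/-- A finite critical exponent is a rational number of bounded height. -/
theorem exists_criticalExponent_eq {k : ℕ} (hk : 2 ≤ k) {σ : Type*} [Fintype σ] {Δ : Type u}
    {st : ℕ → σ} {step : σ → ℕ → σ} (hst : ∀ m d, d < k → st (d + k * m) = step (st m) d)
    (out : σ → Δ) (hfin : criticalExponent (fun m => out (st m)) ≠ ∞) :
    ∃ u v : ℕ, 0 < v ∧ u < k ^ (2 ^ 2 ^ repIndexCard (Fintype.card σ) * 2 + 1) ∧
      v < k ^ (2 ^ 2 ^ repIndexCard (Fintype.card σ) * 2 + 1) ∧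
      criticalExponent (fun m => out (st m)) = (u : ℝ≥0∞) / (v : ℝ≥0∞) := by
  classical
  -- The position is quantified away, because comparing ratios requires a relation between `p` and
  -- `q` alone.
  have hc := (((digitClosed_repRel hk hst out).all (by omega)).ex (by omega)).and
    (digitClosed_posRel hk)
  set a : ℕ → Δ := fun m => out (st m) with ha
  have key : ∀ z : Fin 2 → ℕ, (0 < z 0 ∧ ∃ i, HasRepetition a i (z 0) (z 1)) ↔ _ := fun z =>
    (show _ ↔ (∃ S ∈ ({{(id, id, 2, 0, 0)}} : Set (Set (RepIndex σ))), ∃ i, ∀ s ∈ S, ∀ j,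
        RepRel st out s (Fin.cons j (Fin.cons i z : Fin 3 → ℕ))) ∧ PosRel false z by
      simp only [Set.mem_singleton_iff, exists_eq_left, PosRel, Bool.false_eq_true, false_or]
      rw [and_comm]
      refine and_congr_left' (exists_congr fun i => ?_)
      exact hasRepetition_iff st out (Fin.cons i z : Fin 3 → ℕ))
  obtain ⟨C, hC⟩ : ∃ C : NNReal, (C : ℝ≥0∞) = criticalExponent a := ⟨_, ENNReal.coe_toNNReal hfin⟩
  have hle : ∀ z : Fin 2 → ℕ, (0 < z 0 ∧ ∃ i, HasRepetition a i (z 0) (z 1)) →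
      (z 1 : ℝ) ≤ C * z 0 := by
    rintro z ⟨h0, i, hi⟩
    have := (criticalExponent_le_iff a C).1 hC.ge i _ _ h0 hi
    rw [ENNReal.div_le_iff (by exact_mod_cast h0.ne') (by simp)] at this
    exact_mod_cast this
  have hcard : Fintype.card (Set (Set (RepIndex σ)) × Bool) =
      2 ^ 2 ^ repIndexCard (Fintype.card σ) * 2 := by
    rw [Fintype.card_prod, Fintype.card_set, Fintype.card_set, card_repIndex, Fintype.card_bool]
  have hsmall : ∀ z : Fin 2 → ℕ, (0 < z 0 ∧ ∃ i, HasRepetition a i (z 0) (z 1)) → _ := fun z hz =>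
    hc.exists_small_ratio hk (s := (_, false)) (fun x hx => ((key x).2 hx).1)
      (fun x hx => hle x ((key x).2 hx)) ((key z).1 hz)
  rw [hcard] at hsmall
  set D := k ^ (2 ^ 2 ^ repIndexCard (Fintype.card σ) * 2 + 1)
  -- Pairs in `H` need not come from repetitions: being at most `C` suffices for the maximum to
  -- equal the supremum.
  let H : Finset (ℕ × ℕ) := {w ∈ Finset.range D ×ˢ Finset.range D | 0 < w.2 ∧ (w.1 : ℝ) ≤ C * w.2}
  have hH : H.Nonempty := by
    obtain ⟨u, v, hv, hu1, hv1, huv, -⟩ := hsmall ![1, 1]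
      ⟨by simp, 0, fun j hj => absurd hj (by simp)⟩
    exact ⟨(u, v), by simp [H, *]⟩
  obtain ⟨w, hw, hmax⟩ := H.exists_max_image (fun w => (w.1 : ℝ≥0∞) / (w.2 : ℝ≥0∞)) hH
  simp only [H, Finset.mem_filter, Finset.mem_product, Finset.mem_range] at hw
  obtain ⟨⟨hw1, hw2⟩, hw3, hw4⟩ := hw
  refine ⟨w.1, w.2, hw3, hw1, hw2, le_antisymm ?_ ?_⟩
  · rw [criticalExponent_le_iff]
    intro i p q hp hr
    obtain ⟨u, v, hv, hu1, hv1, huv, hle'⟩ := hsmall ![p, q] ⟨hp, i, hr⟩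
    refine le_trans ?_ (hmax (u, v) (by simp [H, *]))
    simp only [Matrix.cons_val_zero, Matrix.cons_val_one] at hle'
    exact (natCast_div_le_div_iff hp hv).2 hle'
  · rw [← hC, ENNReal.div_le_iff (by exact_mod_cast hw3.ne') (by simp)]
    exact_mod_cast hw4

/-! ### The state sequence of an automaton with output -/

theorem canonicalRep_add {k : ℕ} (hk : 2 ≤ k) (m d : ℕ) (hd : d < k) (h : d + k * m ≠ 0) :
    canonicalRep hk (d + k * m) = canonicalRep hk m ++ [⟨d, hd⟩] := by
  apply List.map_injective_iff.2 Fin.val_injective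
  simp only [canonicalRep, List.map_append, List.map_pmap, List.pmap_eq_map, List.map_id',
    List.map_cons, List.map_nil]
  rw [Nat.digits_add k (by omega) d m hd, List.reverse_cons]
  by_contra hne
  push Not at hne
  obtain ⟨rfl, rfl⟩ : d = 0 ∧ m = 0 := by omega
  simp at h

namespace DFAO

variable {k : ℕ} {σ : Type*} {Δ : Type u}

/-- The state reached on the canonical representation of `m`. -/
def stateAt (M : DFAO k σ Δ) (hk : 2 ≤ k) (m : ℕ) : σ :=
  (canonicalRep hk m).foldl M.step M.start

theorem stateAt_zero (M : DFAO k σ Δ) (hk : 2 ≤ k) : M.stateAt hk 0 = M.start := by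
  simp [stateAt, canonicalRep]

theorem stateAt_add (M : DFAO k σ Δ) (hk : 2 ≤ k) (m d : ℕ) (hd : d < k) (h : d + k * m ≠ 0) :
    M.stateAt hk (d + k * m) = M.step (M.stateAt hk m) ⟨d, hd⟩ := by
  simp [stateAt, canonicalRep_add hk m d hd h]

/-- The state sequence with an additional initial state, on which leading zeros have no effect. -/
def optionStateAt (M : DFAO k σ Δ) (hk : 2 ≤ k) (m : ℕ) : Option σ :=
  if m = 0 then none else some (M.stateAt hk m)

/-- The transitions of `optionStateAt`. -/
def optionStep (M : DFAO k σ Δ) : Option σ → ℕ → Option σ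
  | none, 0 => none
  | o, d => if h : d < k then some (M.step (o.getD M.start) ⟨d, h⟩) else none

theorem getD_optionStateAt (M : DFAO k σ Δ) (hk : 2 ≤ k) (m : ℕ) :
    (M.optionStateAt hk m).getD M.start = M.stateAt hk m := by
  rw [optionStateAt]
  split_ifs with h
  · rw [h, stateAt_zero, Option.getD_none]
  · rfl

/-- The extra state makes this hold for `d = m = 0` as well, where `stateAt_add` can fail because
the initial state may move on the digit 0. -/
theorem optionStateAt_add (M : DFAO k σ Δ) (hk : 2 ≤ k) (m d : ℕ) (hd : d < k) :
    M.optionStateAt hk (d + k * m) = M.optionStep (M.optionStateAt hk m) d := by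
  by_cases h : d + k * m = 0
  · obtain ⟨rfl, h2⟩ : d = 0 ∧ k * m = 0 := by omega
    obtain rfl : m = 0 := by
      rcases Nat.mul_eq_zero.1 h2 with h | h <;> omega
    rfl
  · have hs : M.optionStep (M.optionStateAt hk m) d =
        some (M.step ((M.optionStateAt hk m).getD M.start) ⟨d, hd⟩) := by
      unfold optionStep
      split
      · next h1 =>
        exfalso
        rw [optionStateAt] at h1
        split_ifs at h1 with h2
        exact h (by simp [h2])
      · rw [dif_pos hd]
    rw [hs, getD_optionStateAt, ← stateAt_add M hk m d hd h, optionStateAt, if_neg h]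

theorem sequence_eq (M : DFAO k σ Δ) (hk : 2 ≤ k) :
    M.sequence hk = fun m => M.output ((M.optionStateAt hk m).getD M.start) := by
  funext m
  rw [getD_optionStateAt]
  rfl

end DFAO

/-! ### Computing with the codes of automata -/

/-- The type of descriptions of automata. -/
abbrev DFAOCode := ℕ × ℕ × List (List ℕ) × List ℕ

namespace DFAOCode

/-- The state sequence of the automaton described by `c`. -/
def stateAt (c : DFAOCode) (m : ℕ) : ℕ :=
  if m = 0 ∨ c.1 < 2 then c.2.1
  else (c.2.2.1.getD (stateAt c (m / c.1)) []).getD (m % c.1) 0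
termination_by m
decreasing_by exact Nat.div_lt_self (by omega) (by omega)

/-- The encoded output sequence of the automaton described by `c`. -/
def valueAt (c : DFAOCode) (m : ℕ) : ℕ := c.2.2.2.getD (stateAt c m) 0

/-- A bound for positions and lengths of witnesses of an exponent greater than `u / v`. -/
def witnessBound (c : DFAOCode) (u v : ℕ) : ℕ :=
  c.1 ^ (2 ^ repIndexCard (c.2.2.1.length + 1) * (2 * (u + v + 2)))

/-- A bound for the height of the critical exponent. -/
def heightBound (c : DFAOCode) : ℕ :=
  c.1 ^ (2 ^ 2 ^ repIndexCard (c.2.2.1.length + 1) * 2 + 1)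

/-- There is an exponent greater than `u / v` within the bounds. -/
def Exceeds (c : DFAOCode) (u v : ℕ) : Prop :=
  ∃ i < witnessBound c u v, ∃ p < witnessBound c u v, ∃ q < witnessBound c u v,
    0 < p ∧ u * p < v * q ∧ ∀ j < q, j + p < q → valueAt c (i + j) = valueAt c (i + j + p)

/-- The pair coded by `w` represents an upper bound for the critical exponent. -/
def IsBound (c : DFAOCode) (w : ℕ) : Prop :=
  0 < w.unpair.2 ∧ ¬ Exceeds c w.unpair.1 w.unpair.2

/-- The pair coded by `w` represents the least upper bound of bounded height. -/
def IsLeastBound (c : DFAOCode) (w : ℕ) : Prop :=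
  IsBound c w ∧ ∀ w' < heightBound c ^ 2, IsBound c w' →
    w.unpair.1 * w'.unpair.2 ≤ w'.unpair.1 * w.unpair.2

open Classical in
/-- The algorithm computing the critical exponent. -/
noncomputable def solve (c : DFAOCode) : Option (ℕ × ℕ) :=
  ((List.range (heightBound c ^ 2)).filter fun w => IsLeastBound c w).head?.map Nat.unpair

/-! ### Primitive recursiveness of the algorithm. -/

section Primrec

open Primrec

theorem primrec_pow : Primrec₂ fun a b : ℕ => a ^ b :=
  (nat_rec (f := fun _ : ℕ => 1) (g := fun a (y : ℕ × ℕ) => y.2 * a) (const 1)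
    (nat_mul.comp (snd.comp snd) fst)).of_eq fun a b => by
      induction b with
      | zero => rfl
      | succ b ih => simp only at ih ⊢; rw [ih, pow_succ]

theorem primrecPred_exists_lt {α : Type*} [Primcodable α] {b : α → ℕ} {R : ℕ → α → Prop}
    (hb : Primrec b) (hR : PrimrecPred fun y : ℕ × α => R y.1 y.2) :
    PrimrecPred fun a => ∃ x < b a, R x a :=
  (PrimrecRel.comp (PrimrecRel.exists_mem_list (R := R) hR) (list_range.comp hb) .id).of_eq
    fun a => by simp

theorem primrecPred_forall_lt {α : Type*} [Primcodable α] {b : α → ℕ} {R : ℕ → α → Prop}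
    (hb : Primrec b) (hR : PrimrecPred fun y : ℕ × α => R y.1 y.2) :
    PrimrecPred fun a => ∀ x < b a, R x a :=
  (PrimrecRel.comp (PrimrecRel.forall_mem_list (R := R) hR) (list_range.comp hb) .id).of_eq
    fun a => by simp

theorem primrecPred_imp {α : Type*} [Primcodable α] {p q : α → Prop} (hp : PrimrecPred p)
    (hq : PrimrecPred q) : PrimrecPred fun a => p a → q a :=
  (hp.not.or hq).of_eq fun _ => imp_iff_not_or.symm

theorem primrec_stateAt : Primrec₂ stateAt := by
  let T : DFAOCode × List ℕ → List (List ℕ) := fun y => y.1.2.2.1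
  have hT : Primrec T := fst.comp (snd.comp (snd.comp fst))
  have hk : Primrec fun y : DFAOCode × List ℕ => y.1.1 := fst.comp fst
  have hl : Primrec fun y : DFAOCode × List ℕ => y.2.length := list_length.comp snd
  -- Course-of-values recursion: `l` lists the states at all smaller arguments.
  refine nat_strong_rec (g := fun c l => some (if l.length = 0 ∨ c.1 < 2 then c.2.1 else
    (c.2.2.1.getD (l.getD (l.length / c.1) 0) []).getD (l.length % c.1) 0)) _ ?_ ?_
  · refine option_some.comp (Primrec.ite ?_ ?_ ?_)
    · exact (Primrec.eq.comp hl (const 0)).or (nat_lt.comp hk (const 2))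
    · exact fst.comp (snd.comp fst)
    · exact (list_getD 0).comp ((list_getD []).comp hT
        ((list_getD 0).comp snd (nat_div.comp hl hk))) (nat_mod.comp hl hk)
  · intro c n
    rw [stateAt]
    simp only [List.length_map, List.length_range, Option.some_inj]
    split_ifs with h
    · rfl
    · have : n / c.1 < n := Nat.div_lt_self (by omega) (by omega)
      simp [List.getD_eq_getElem?_getD, this]

theorem primrec_valueAt : Primrec₂ valueAt :=
  (list_getD 0).comp (snd.comp (snd.comp (snd.comp fst))) (primrec_stateAt.comp fst snd)

theorem primrec_repIndexCard : Primrec repIndexCard :=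
  nat_mul.comp (primrec_pow.comp .id .id) (nat_mul.comp (primrec_pow.comp .id .id) (const 24))

theorem primrec_card : Primrec fun c : DFAOCode => 2 ^ repIndexCard (c.2.2.1.length + 1) :=
  primrec_pow.comp (const 2) (primrec_repIndexCard.comp
    (succ.comp (list_length.comp (fst.comp (snd.comp snd)))))

theorem primrec_heightBound : Primrec heightBound :=
  primrec_pow.comp fst (succ.comp (nat_mul.comp (primrec_pow.comp (const 2) primrec_card) (const 2)))

theorem primrec_witnessBound :
    Primrec fun y : DFAOCode × ℕ × ℕ => witnessBound y.1 y.2.1 y.2.2 :=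
  primrec_pow.comp (fst.comp fst) (nat_mul.comp (primrec_card.comp fst)
    (nat_mul.comp (const 2) (nat_add.comp (nat_add.comp (fst.comp snd) (snd.comp snd)) (const 2))))

theorem primrecPred_exceeds :
    PrimrecPred fun y : DFAOCode × ℕ × ℕ => Exceeds y.1 y.2.1 y.2.2 := by
  have hB := primrec_witnessBound
  refine primrecPred_exists_lt hB (primrecPred_exists_lt (hB.comp snd)
    (primrecPred_exists_lt (hB.comp (snd.comp snd)) ?_))
  have hq : Primrec fun y : ℕ × ℕ × ℕ × DFAOCode × ℕ × ℕ => y.1 := fst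
  have hp : Primrec fun y : ℕ × ℕ × ℕ × DFAOCode × ℕ × ℕ => y.2.1 := fst.comp snd
  have hi : Primrec fun y : ℕ × ℕ × ℕ × DFAOCode × ℕ × ℕ => y.2.2.1 := fst.comp (snd.comp snd)
  have hy : Primrec fun y : ℕ × ℕ × ℕ × DFAOCode × ℕ × ℕ => y.2.2.2 := snd.comp (snd.comp snd)
  refine (nat_lt.comp (const 0) hp).and ((nat_lt.comp (nat_mul.comp (fst.comp (snd.comp hy)) hp)
    (nat_mul.comp (snd.comp (snd.comp hy)) hq)).and (primrecPred_forall_lt hq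
      (primrecPred_imp (nat_lt.comp (nat_add.comp fst (hp.comp snd)) (hq.comp snd)) ?_)))
  have hij := nat_add.comp (hi.comp snd) (fst (α := ℕ) (β := ℕ × ℕ × ℕ × DFAOCode × ℕ × ℕ))
  have hc := fst.comp (hy.comp (snd (α := ℕ)))
  exact Primrec.eq.comp (primrec_valueAt.comp hc hij)
    (primrec_valueAt.comp hc (nat_add.comp hij (hp.comp snd)))

theorem primrecRel_isBound : PrimrecRel IsBound := by
  have h1 : Primrec fun y : DFAOCode × ℕ => y.2.unpair.1 := fst.comp (unpair.comp snd)
  have h2 : Primrec fun y : DFAOCode × ℕ => y.2.unpair.2 := snd.comp (unpair.comp snd)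
  exact (nat_lt.comp (const 0) h2).and
    (primrecPred_exceeds.comp (fst.pair (h1.pair h2))).not

theorem primrecRel_isLeastBound : PrimrecRel IsLeastBound := by
  have hW : Primrec fun c : DFAOCode => heightBound c ^ 2 :=
    primrec_pow.comp primrec_heightBound (const 2)
  refine PrimrecPred.and primrecRel_isBound (primrecPred_forall_lt (hW.comp fst)
    (primrecPred_imp (primrecRel_isBound.comp (fst.comp snd) fst) ?_))
  have hu := unpair.comp (snd.comp (snd (α := ℕ) (β := DFAOCode × ℕ)))
  have hu' := unpair.comp (fst (α := ℕ) (β := DFAOCode × ℕ))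
  exact nat_le.comp (nat_mul.comp (fst.comp hu) (snd.comp hu'))
    (nat_mul.comp (fst.comp hu') (snd.comp hu))

theorem primrec_solve : Primrec solve := by
  classical
  have hR : PrimrecRel fun (w : ℕ) (c : DFAOCode) => IsLeastBound c w :=
    primrecRel_isLeastBound.comp snd fst
  have hW : Primrec fun c : DFAOCode => heightBound c ^ 2 :=
    primrec_pow.comp primrec_heightBound (const 2)
  refine (option_map (list_head?.comp (hR.listFilter.comp (list_range.comp hW) .id))
    (unpair.comp snd).to₂).of_eq fun c => ?_
  simp only [solve, id]

end Primrec

/-! ### Correctness of the algorithm. -/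

theorem stateAt_code {k n : ℕ} (hk : 2 ≤ k) {Δ : Type u} [Encodable Δ] (M : DFAO k (Fin n) Δ)
    (m : ℕ) : stateAt M.code m = M.stateAt hk m := by
  induction m using Nat.strong_induction_on with
  | _ m ih =>
    rw [stateAt]
    split_ifs with h
    · rcases h with rfl | h
      · rw [DFAO.stateAt_zero]; rfl
      · exact absurd h (not_lt.2 hk)
    · push Not at h
      have hd : m % k < k := Nat.mod_lt _ (by omega)
      have h1 := DFAO.stateAt_add M hk (m / k) (m % k) hd (by rw [Nat.mod_add_div]; exact h.1)
      rw [Nat.mod_add_div] at h1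
      rw [h1, show M.code.1 = k from rfl, ih _ (Nat.div_lt_self (by omega) hk)]
      simp [DFAO.code, List.getD_eq_getElem?_getD, hd]

theorem valueAt_code {k n : ℕ} (hk : 2 ≤ k) {Δ : Type u} [Encodable Δ] (M : DFAO k (Fin n) Δ)
    (m : ℕ) : valueAt M.code m = Encodable.encode (M.sequence hk m) := by
  rw [valueAt, stateAt_code hk]
  simp [DFAO.code, List.getD_eq_getElem?_getD, DFAO.sequence, DFAO.stateAt]

/-- The bounded search is exhaustive by `exists_small_hasRepetition`; the `+ 1` in `witnessBound`
counts the extra state of `optionStateAt`. -/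
theorem exceeds_code_iff {k n : ℕ} (hk : 2 ≤ k) {Δ : Type u} [Encodable Δ]
    (M : DFAO k (Fin n) Δ) (u v : ℕ) (hv : 0 < v) :
    ¬ Exceeds M.code u v ↔ criticalExponent (M.sequence hk) ≤ (u : ℝ≥0∞) / (v : ℝ≥0∞) := by
  rw [criticalExponent_le_iff, ← not_iff_not, not_not]
  push Not
  have hrep : ∀ i p q, (∀ j < q, j + p < q →
      valueAt M.code (i + j) = valueAt M.code (i + j + p)) ↔
      HasRepetition (M.sequence hk) i p q := fun i p q => by
    simp only [valueAt_code hk, Encodable.encode_inj]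
    exact forall_congr' fun j => ⟨fun h h' => h (by omega) h', fun h _ => h⟩
  simp only [Exceeds, hrep]
  constructor
  · rintro ⟨i, -, p, -, q, -, hp, hlt, hr⟩
    refine ⟨i, p, q, hp, hr, ?_⟩
    rw [← not_le, natCast_div_le_div_iff hp hv]
    linarith
  · rintro ⟨i, p, q, hp, hr, hlt⟩
    rw [← not_le, natCast_div_le_div_iff hp hv] at hlt
    rw [M.sequence_eq hk] at hr ⊢
    refine exists_small_hasRepetition hk (M.optionStateAt_add hk)
      (fun o => M.output (o.getD M.start)) hp hr (by linarith) (le_of_eq ?_)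
    simp [witnessBound, DFAO.code]

/-- A finite critical exponent is itself a candidate of bounded height, so the least candidate
equals it. Conversely, any candidate forces finiteness. -/
theorem denotes_solve {k n : ℕ} (hk : 2 ≤ k) {Δ : Type u} [Encodable Δ] (M : DFAO k (Fin n) Δ) :
    Denotes (solve M.code) (criticalExponent (M.sequence hk)) := by
  classical
  have hb : ∀ w, IsBound M.code w ↔ 0 < w.unpair.2 ∧ criticalExponent (M.sequence hk) ≤
      (w.unpair.1 : ℝ≥0∞) / (w.unpair.2 : ℝ≥0∞) := fun w =>
    and_congr_right fun h => exceeds_code_iff hk M _ _ h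
  have hex : criticalExponent (M.sequence hk) ≠ ∞ → ∃ w < heightBound M.code ^ 2,
      0 < w.unpair.2 ∧ criticalExponent (M.sequence hk) =
        (w.unpair.1 : ℝ≥0∞) / (w.unpair.2 : ℝ≥0∞) := by
    intro hfin
    rw [M.sequence_eq hk] at hfin ⊢
    obtain ⟨u, v, hv, hu, hv', he⟩ := exists_criticalExponent_eq hk (M.optionStateAt_add hk)
      (fun o => M.output (o.getD M.start)) hfin
    have hD : k ^ (2 ^ 2 ^ repIndexCard (Fintype.card (Option (Fin n))) * 2 + 1) =
        heightBound M.code := by simp [heightBound, DFAO.code]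
    rw [hD] at hu hv'
    -- Pairs with entries below the height bound have codes below its square, the range searched by
    -- `solve`.
    refine ⟨Nat.pair u v, (Nat.pair_lt_max_add_one_sq u v).trans_le
      (Nat.pow_le_pow_left (by omega) 2), ?_⟩
    simpa using ⟨hv, he⟩
  rw [solve]
  cases hh : ((List.range (heightBound M.code ^ 2)).filter
    fun w => IsLeastBound M.code w).head? with
  | none =>
    change criticalExponent _ = ∞
    by_contra hfin
    obtain ⟨w, hw, hv, he⟩ := hex hfin
    rw [List.head?_eq_none_iff, List.filter_eq_nil_iff] at hh
    refine hh w (List.mem_range.2 hw) (decide_eq_true ⟨(hb w).2 ⟨hv, he.le⟩, fun w' _ hw' => ?_⟩)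
    obtain ⟨h1, h2⟩ := (hb w').1 hw'
    rw [he] at h2
    exact (natCast_div_le_div_iff hv h1).1 h2
  | some w =>
    have hmem := List.mem_of_head? hh
    rw [List.mem_filter, decide_eq_true_eq] at hmem
    obtain ⟨hw, hmin⟩ := hmem.2
    obtain ⟨hv, hle⟩ := (hb w).1 hw
    refine ⟨hv, le_antisymm hle ?_⟩
    have hne : criticalExponent (M.sequence hk) ≠ ∞ := fun h => by
      rw [h, top_le_iff, ENNReal.div_eq_top] at hle
      simp [hv.ne'] at hle
    obtain ⟨w', hw', hv', he⟩ := hex hne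
    rw [he]
    exact (natCast_div_le_div_iff hv hv').2 (hmin w' hw' ((hb w').2 ⟨hv', he.le⟩))

end DFAOCode

theorem mainTheorem1 :
    (∀ (k : ℕ) (hk : 2 ≤ k) (Δ : Type u) (a : ℕ → Δ), IsAutomatic hk a →
      (∃ r : ℚ≥0, criticalExponent a = ((r : NNReal) : ℝ≥0∞)) ∨ criticalExponent a = ∞) ∧
    (∃ f : ℕ × ℕ × List (List ℕ) × List ℕ → Option (ℕ × ℕ), Computable f ∧
      ∀ (k : ℕ) (hk : 2 ≤ k) (n : ℕ) (Δ : Type u) [Encodable Δ] (M : DFAO k (Fin n) Δ),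
        Denotes (f M.code) (criticalExponent (M.sequence hk))) := by
  refine ⟨?_, DFAOCode.solve, DFAOCode.primrec_solve.to_comp, fun k hk n Δ _ M =>
    DFAOCode.denotes_solve hk M⟩
  rintro k hk Δ _ ⟨σ, hσ, M, rfl⟩
  cases nonempty_fintype σ
  refine or_iff_not_imp_right.2 fun hfin => ?_
  rw [M.sequence_eq hk] at hfin ⊢
  obtain ⟨u, v, hv, -, -, he⟩ := exists_criticalExponent_eq hk (M.optionStateAt_add hk)
    (fun o => M.output (o.getD M.start)) hfin
  refine ⟨(u : ℚ≥0) / v, he.trans ?_⟩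
  have hv' : (v : NNReal) ≠ 0 := by exact_mod_cast hv.ne'
  push_cast
  rw [ENNReal.coe_div hv']
  simp
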